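/- **Setting.** In the $k$-server problem on the line ($k\ge 1$), $k$ servers start in an initial configuration $C_0=(s_1\le\dots\le s_k)\in\mathbb R^k$. Requests $r_1,\dots,r_n\in\mathbb R$ arrive online; after each request at least one server must be at the requested point, and the cost is the total distance travelled by the servers. $\mathrm{Opt}$ denotes the infimum of the costs of all offline solutions. A prediction is a sequence $p_1,\dots,p_n\in\{1,\dots,k\}$; $p_t$ is revealed together with $r_t$. The algorithm FtP serves every $r_t$ by moving its $p_t$-th server from the left (and then relabels its servers from left to right); $\mathrm{FtP}$ is its cost, and the prediction error is $\eta=\mathrm{FtP}-\mathrm{Opt}$. An online algorithm has competitive ratio at most $\mu$ (where $\mu$ may depend on the instance) if for every $C_0$ there is a constant $c\ge 0$ such that its cost is at most $\mu\cdot\mathrm{Opt}+c$ for all request and prediction sequences. It is $a$-consistent if this holds with $\mu=a$ on all instances with $\eta=0$, and $b$-robust if it holds with $\mu=b$ on all instances. It is memory-constrained if (i) its next configuration depends only on its current configuration, the request and the prediction, and (ii) for any $k$ distinct points and any starting configuration there is a finite sequence of requests (with predictions) among these points after which each of the points holds exactly one server. For $\lambda\in[0,1]$, the algorithm LambdaDC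 does the following on request $r$ with prediction $p$ when its servers are at $s_1\le\dots\le s_k$. If some server is at $r$, nothing moves. If $r<s_1$ or $r>s_k$, only the closest server ($s_1$, respectively $s_k$) moves, to $r$. If $s_i<r<s_{i+1}$, then both $s_i$ and $s_{i+1}$ move towards $r$ until one of them reaches $r$; if $p\le i$, then $s_i$ has speed $1$ and $s_{i+1}$ has speed $\lambda$, and if $p\ge i+1$ the speeds are swapped. **Theorem 1.** Let $k\ge1$ and $\lambda\in[0,1]$. Let $\beta(k)=\sum_{i=0}^{k-1}\lambda^{-i}$ if $\lambda>0$ and $\beta(k)=\infty$ if $\lambda=0$, and let $$\alpha(k)=\begin{cases}1+2\lambda+2\lambda^2+\dots+2\lambda^{(k-1)/2}&\text{if }k\text{ is odd},\\ 1+2\lambda+2\lambda^2+\dots+2\lambda^{k/2-1}+\lambda^{k/2}&\text{if }k\text{ is even}.\end{cases}$$ Then LambdaDC is a memory-constrained learning-augmented online algorithm for the $k$-server problem on the line with competitive ratio at most $$\min\left\{\alpha(k)\left(1+\frac{\eta}{\mathrm{Opt}}\right),\ \beta(k)\right\},$$ where for $\mathrm{Opt}=0$ the bound means that the cost of LambdaDC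 is at most $c$. In particular, LambdaDC is $\alpha(k)$-consistent, and for $\lambda>0$ it is $\beta(k)$-robust. -/

import Mathlib

open scoped NNReal ENNReal

/-- A configuration of `k` servers on the line: their positions, listed from left to right. -/
abbrev Config (k : ℕ) : Type := {s : Fin k → ℝ // Monotone s}

/-- Total distance travelled by the servers when they move from `s` to `t`. -/
noncomputable def moveCost {k : ℕ} (s t : Fin k → ℝ) : ℝ := ∑ i, |s i - t i|

/-- Cost of the first `n` moves of a sequence of server positions. -/
noncomputable def scheduleCost {k : ℕ} (S : ℕ → Fin k → ℝ) (n : ℕ) : ℝ :=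
  ∑ t ∈ Finset.range n, moveCost (S t) (S (t + 1))

/-- `S` starts in `C₀` and serves the requests `rs` one after the other. Overtakings of servers
are allowed here. -/
def IsSchedule {k : ℕ} (C₀ : Config k) (rs : List ℝ) (S : ℕ → Fin k → ℝ) : Prop :=
  S 0 = C₀.1 ∧ ∀ (t : ℕ) (ht : t < rs.length), ∃ i, S (t + 1) i = rs[t]

/-- Cost of an optimal (offline) solution. -/
noncomputable def opt {k : ℕ} (C₀ : Config k) (rs : List ℝ) : ℝ :=
  sInf {c : ℝ | ∃ S : ℕ → Fin k → ℝ, IsSchedule C₀ rs S ∧ c = scheduleCost S rs.length}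

/-- A (deterministic) learning-augmented online algorithm for the `k`-server problem on the line.
Each input item is a request together with the index of the predicted server;
`config C₀ σ` is the configuration reached from the initial configuration `C₀` after the
input `σ`, so it cannot depend on future requests or predictions. -/
structure OnlineAlgorithm (k : ℕ) where
  config : Config k → List (ℝ × Fin k) → Config k
  config_nil : ∀ C₀, config C₀ [] = C₀
  serves : ∀ C₀ σ r p, ∃ i, (config C₀ (σ ++ [(r, p)])).1 i = r

/-- Total cost of the algorithm on the input `σ` from the initial configuration `C₀`. -/
noncomputable def OnlineAlgorithm.cost {k : ℕ} (A : OnlineAlgorithm k) (C₀ : Config k)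
    (σ : List (ℝ × Fin k)) : ℝ :=
  scheduleCost (fun t => (A.config C₀ (σ.take t)).1) σ.length

/-- The algorithm that starts in the given configuration and determines each next configuration
from the current one, the request and the prediction. -/
def OnlineAlgorithm.ofStep {k : ℕ} (step : Config k → ℝ → Fin k → Config k)
    (h : ∀ C r p, ∃ i, (step C r p).1 i = r) : OnlineAlgorithm k where
  config C₀ σ := σ.foldl (fun C x => step C x.1 x.2) C₀
  config_nil _ := rfl
  serves C₀ σ r p := by
    simpa [List.foldl_append] using h _ r p

/-- Memory-constrained algorithms: every decision depends only on the current configuration, the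
request and the prediction; and the memory is erasable, that is, for any `k` distinct points and
any starting configuration there is a finite sequence of requests (with predictions) among these
points after which each of the points holds exactly one server. -/
def OnlineAlgorithm.IsMemoryConstrained {k : ℕ} (A : OnlineAlgorithm k) : Prop :=
  (∃ step : Config k → ℝ → Fin k → Config k, ∀ C₀ σ r p,
      A.config C₀ (σ ++ [(r, p)]) = step (A.config C₀ σ) r p) ∧
  ∀ P : Finset ℝ, P.card = k → ∀ C₀ : Config k, ∃ σ : List (ℝ × Fin k),
    (∀ x ∈ σ, x.1 ∈ P) ∧ ∀ q ∈ P, ∃! i, (A.config C₀ σ).1 i = q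

/-- Follow the predictions: the predicted server moves to the request, and the servers are then
relabelled from left to right. -/
noncomputable def ftpStep {k : ℕ} (C : Config k) (r : ℝ) (p : Fin k) : Config k :=
  ⟨Function.update C.1 p r ∘ Tuple.sort (Function.update C.1 p r), Tuple.monotone_sort _⟩

theorem ftpStep_serves {k : ℕ} (C : Config k) (r : ℝ) (p : Fin k) :
    ∃ i, (ftpStep C r p).1 i = r :=
  ⟨(Tuple.sort (Function.update C.1 p r)).symm p, by simp [ftpStep]⟩

/-- The algorithm that simply follows the predictions. -/
noncomputable def ftp (k : ℕ) : OnlineAlgorithm k := .ofStep ftpStep ftpStep_serves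

/-- The prediction error `η`. -/
noncomputable def predictionError {k : ℕ} (C₀ : Config k) (σ : List (ℝ × Fin k)) : ℝ :=
  (ftp k).cost C₀ σ - opt C₀ (σ.map Prod.fst)

/-- The algorithm has competitive ratio at most `μ`, where `μ` may depend on the instance. The
additive constant depends only on the initial configuration. -/
def OnlineAlgorithm.IsCompetitive {k : ℕ} (A : OnlineAlgorithm k)
    (μ : Config k → List (ℝ × Fin k) → ℝ≥0∞) : Prop :=
  ∀ C₀ : Config k, ∃ c : ℝ≥0, ∀ σ : List (ℝ × Fin k),
    ENNReal.ofReal (A.cost C₀ σ) ≤ μ C₀ σ * ENNReal.ofReal (opt C₀ (σ.map Prod.fst)) + c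

/-- `a`-consistency: `a`-competitiveness on the inputs with prediction error `0`. -/
def OnlineAlgorithm.IsConsistent {k : ℕ} (A : OnlineAlgorithm k) (a : ℝ≥0∞) : Prop :=
  ∀ C₀ : Config k, ∃ c : ℝ≥0, ∀ σ : List (ℝ × Fin k), predictionError C₀ σ = 0 →
    ENNReal.ofReal (A.cost C₀ σ) ≤ a * ENNReal.ofReal (opt C₀ (σ.map Prod.fst)) + c

/-- `b`-robustness: `b`-competitiveness whatever the prediction error is. -/
def OnlineAlgorithm.IsRobust {k : ℕ} (A : OnlineAlgorithm k) (b : ℝ≥0∞) : Prop :=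
  A.IsCompetitive fun _ _ => b

/-- Servers strictly to the left of the point `r`. -/
noncomputable def leftOf {k : ℕ} (s : Fin k → ℝ) (r : ℝ) : Finset (Fin k) :=
  Finset.univ.filter fun i => s i < r

/-- Servers strictly to the right of the point `r`. -/
noncomputable def rightOf {k : ℕ} (s : Fin k → ℝ) (r : ℝ) : Finset (Fin k) :=
  Finset.univ.filter fun i => r < s i

/-- The point reached from `x` by moving a distance `d` in the direction of `r`. -/
noncomputable def moveTowards (x r d : ℝ) : ℝ := if x < r then x + d else x - d

/-- The time at which the first of two servers reaches `r` if one starts in `x` with speed `1`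
and the other starts in `y` with speed `lam`. (For `lam = 0` only the first one ever arrives.) -/
noncomputable def arrivalTime (lam x y r : ℝ) : ℝ :=
  if lam * |r - x| ≤ |r - y| then |r - x| else |r - y| / lam

/-- Move server `f` with speed `1` and server `g` with speed `lam` towards `r` until one of them
reaches `r`. -/
noncomputable def raceMove {k : ℕ} (lam : ℝ) (s : Fin k → ℝ) (r : ℝ) (f g : Fin k) :
    Fin k → ℝ :=
  let T := arrivalTime lam (s f) (s g) r
  Function.update (Function.update s f (moveTowards (s f) r T)) g (moveTowards (s g) r (lam * T))

/-- New server positions chosen by LambdaDC: no move if the request is covered; only the closest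
server moves if all servers are on the same side of the request; otherwise both neighbours of the
request move, the one on the side of the predicted server with speed `1` and the other one with
speed `lam`. -/
noncomputable def lambdaDCMove {k : ℕ} (lam : ℝ) (s : Fin k → ℝ) (r : ℝ) (p : Fin k) :
    Fin k → ℝ :=
  open Classical in
  if ∃ i, s i = r then s
  else if hL : (leftOf s r).Nonempty then
    if hR : (rightOf s r).Nonempty then
      if p ≤ (leftOf s r).max' hL then
        raceMove lam s r ((leftOf s r).max' hL) ((rightOf s r).min' hR)
      else raceMove lam s r ((rightOf s r).min' hR) ((leftOf s r).max' hL)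
    else Function.update s ((leftOf s r).max' hL) r
  else if hR : (rightOf s r).Nonempty then Function.update s ((rightOf s r).min' hR) r
  else s

theorem race_bounds {lam x y r : ℝ} (h0 : 0 ≤ lam) (hx : x < r) (hy : r < y) :
    (x ≤ moveTowards x r (arrivalTime lam x y r) ∧
      moveTowards x r (arrivalTime lam x y r) ≤ r ∧
      r ≤ moveTowards y r (lam * arrivalTime lam x y r) ∧
      moveTowards y r (lam * arrivalTime lam x y r) ≤ y ∧
      (moveTowards x r (arrivalTime lam x y r) = r ∨
        moveTowards y r (lam * arrivalTime lam x y r) = r)) ∧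
    (x ≤ moveTowards x r (lam * arrivalTime lam y x r) ∧
      moveTowards x r (lam * arrivalTime lam y x r) ≤ r ∧
      r ≤ moveTowards y r (arrivalTime lam y x r) ∧
      moveTowards y r (arrivalTime lam y x r) ≤ y ∧
      (moveTowards x r (lam * arrivalTime lam y x r) = r ∨
        moveTowards y r (arrivalTime lam y x r) = r)) := by
  have e1 : |r - x| = r - x := abs_of_pos (by linarith)
  have e2 : |r - y| = y - r := by rw [abs_of_neg (by linarith)]; ring
  have hy' : ¬ y < r := not_lt.2 hy.le
  simp only [moveTowards, arrivalTime, e1, e2, if_pos hx, if_neg hy']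
  constructor
  · split_ifs with h
    · have := mul_nonneg h0 (sub_nonneg.2 hx.le)
      exact ⟨by linarith, by linarith, by linarith, by linarith, Or.inl (by ring)⟩
    · push Not at h
      have hl : 0 < lam := by
        rcases h0.eq_or_lt with rfl | h'
        · simp at h; linarith
        · exact h'
      have h1 : (y - r) / lam < r - x := by rw [div_lt_iff₀ hl]; linarith
      have h2 : 0 < (y - r) / lam := div_pos (by linarith) hl
      have h3 : lam * ((y - r) / lam) = y - r := by field_simp
      rw [h3]
      exact ⟨by linarith, by linarith, by linarith, by linarith, Or.inr (by ring)⟩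
  · split_ifs with h
    · have := mul_nonneg h0 (sub_nonneg.2 hy.le)
      exact ⟨by linarith, by linarith, by linarith, by linarith, Or.inr (by ring)⟩
    · push Not at h
      have hl : 0 < lam := by
        rcases h0.eq_or_lt with rfl | h'
        · simp at h; linarith
        · exact h'
      have h1 : (r - x) / lam < y - r := by rw [div_lt_iff₀ hl]; linarith
      have h2 : 0 < (r - x) / lam := div_pos (by linarith) hl
      have h3 : lam * ((r - x) / lam) = r - x := by field_simp
      rw [h3]
      exact ⟨by linarith, by linarith, by linarith, by linarith, Or.inl (by ring)⟩

theorem monotone_of_neighbours {k : ℕ} {s t : Fin k → ℝ} {r : ℝ} (hs : Monotone s)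
    {i j : Fin k} (hij : ∀ a, a ≤ i ∨ j ≤ a) (hlt : i < j)
    (ht : ∀ a, a ≠ i → a ≠ j → t a = s a)
    (h1 : s i ≤ t i) (h2 : t i ≤ r) (h3 : r ≤ t j) (h4 : t j ≤ s j) : Monotone t := by
  have hl : ∀ a, a ≤ i → s a ≤ t a ∧ t a ≤ t i := by
    intro a ha
    rcases ha.eq_or_lt with rfl | h
    · exact ⟨h1, le_rfl⟩
    · rw [ht a h.ne (h.trans hlt).ne]
      exact ⟨le_rfl, (hs ha).trans h1⟩
  have hr : ∀ a, j ≤ a → t a ≤ s a ∧ t j ≤ t a := by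
    intro a ha
    rcases ha.eq_or_lt with rfl | h
    · exact ⟨h4, le_rfl⟩
    · rw [ht a (hlt.trans h).ne' h.ne']
      exact ⟨le_rfl, h4.trans (hs ha)⟩
  intro a b hab
  rcases hab.eq_or_lt with rfl | hab'
  · exact le_rfl
  rcases hij a with ha | ha
  · rcases hij b with hb | hb
    · rw [ht a (hab'.trans_le hb).ne ((hab'.trans_le hb).trans hlt).ne]
      exact (hs hab).trans (hl b hb).1
    · linarith [(hl a ha).2, (hr b hb).2]
  · have hb := ha.trans hab
    rw [ht b (hlt.trans_le (ha.trans hab)).ne' (ha.trans_lt hab').ne']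
    exact (hr a ha).1.trans (hs hab)

theorem lambdaDCMove_spec {k : ℕ} {lam : ℝ} (h0 : 0 ≤ lam) {s : Fin k → ℝ} (hs : Monotone s)
    (r : ℝ) (p : Fin k) :
    Monotone (lambdaDCMove lam s r p) ∧ ∃ i, lambdaDCMove lam s r p i = r := by
  classical
  unfold lambdaDCMove
  by_cases hc : ∃ i, s i = r
  · simp only [if_pos hc]
    exact ⟨hs, hc⟩
  have hne : ∀ a, s a < r ∨ r < s a := fun a => lt_or_gt_of_ne fun h => hc ⟨a, h⟩
  have memL : ∀ a, a ∈ leftOf s r ↔ s a < r := by simp [leftOf]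
  have memR : ∀ a, a ∈ rightOf s r ↔ r < s a := by simp [rightOf]
  simp only [if_neg hc]
  by_cases hL : (leftOf s r).Nonempty
  · have hi := (memL _).1 ((leftOf s r).max'_mem hL)
    have hi' : ∀ a, s a < r → a ≤ (leftOf s r).max' hL :=
      fun a ha => (leftOf s r).le_max' a ((memL a).2 ha)
    simp only [dif_pos hL]
    set i := (leftOf s r).max' hL
    by_cases hR : (rightOf s r).Nonempty
    · have hj := (memR _).1 ((rightOf s r).min'_mem hR)
      have hj' : ∀ a, r < s a → (rightOf s r).min' hR ≤ a :=
        fun a ha => (rightOf s r).min'_le a ((memR a).2 ha)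
      simp only [dif_pos hR]
      set j := (rightOf s r).min' hR
      have hlt : i < j := lt_of_not_ge fun h => absurd (hs h) (by linarith)
      have hij : ∀ a, a ≤ i ∨ j ≤ a := fun a => (hne a).imp (hi' a) (hj' a)
      obtain ⟨⟨a1, a2, a3, a4, a5⟩, b1, b2, b3, b4, b5⟩ := race_bounds h0 hi hj
      split_ifs
      · have ei : raceMove lam s r i j i =
            moveTowards (s i) r (arrivalTime lam (s i) (s j) r) := by
          simp [raceMove, Function.update_of_ne hlt.ne]
        have ej : raceMove lam s r i j j =
            moveTowards (s j) r (lam * arrivalTime lam (s i) (s j) r) := by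
          simp [raceMove]
        rw [← ei, ← ej] at a5
        refine ⟨monotone_of_neighbours (r := r) hs hij hlt ?_ ?_ ?_ ?_ ?_, ?_⟩
        · intro a h1 h2
          simp [raceMove, h1, h2]
        · rwa [ei]
        · rwa [ei]
        · rwa [ej]
        · rwa [ej]
        · exact a5.elim (fun h => ⟨i, h⟩) fun h => ⟨j, h⟩
      · have ei : raceMove lam s r j i i =
            moveTowards (s i) r (lam * arrivalTime lam (s j) (s i) r) := by
          simp [raceMove]
        have ej : raceMove lam s r j i j =
            moveTowards (s j) r (arrivalTime lam (s j) (s i) r) := by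
          simp [raceMove, Function.update_of_ne hlt.ne']
        rw [← ei, ← ej] at b5
        refine ⟨monotone_of_neighbours (r := r) hs hij hlt ?_ ?_ ?_ ?_ ?_, ?_⟩
        · intro a h1 h2
          simp [raceMove, h1, h2]
        · rwa [ei]
        · rwa [ei]
        · rwa [ej]
        · rwa [ej]
        · exact b5.elim (fun h => ⟨i, h⟩) fun h => ⟨j, h⟩
    · simp only [dif_neg hR]
      have hall : ∀ a, s a < r := fun a =>
        (hne a).resolve_right fun h => hR ⟨a, (memR a).2 h⟩
      refine ⟨fun a b hab => ?_, i, by simp⟩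
      by_cases hb : b = i
      · subst hb
        rw [Function.update_self]
        by_cases ha : a = i
        · rw [ha, Function.update_self]
        · rw [Function.update_of_ne ha]; exact (hall a).le
      · have ha : a ≠ i := fun h => hb (le_antisymm (hi' b (hall b)) (h ▸ hab))
        rw [Function.update_of_ne ha, Function.update_of_ne hb]
        exact hs hab
  · simp only [dif_neg hL]
    have hall : ∀ a, r < s a := fun a =>
      (hne a).resolve_left fun h => hL ⟨a, (memL a).2 h⟩
    have hR : (rightOf s r).Nonempty := ⟨p, (memR p).2 (hall p)⟩
    simp only [dif_pos hR]
    have hj' : ∀ a, (rightOf s r).min' hR ≤ a :=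
      fun a => (rightOf s r).min'_le a ((memR a).2 (hall a))
    set j := (rightOf s r).min' hR
    refine ⟨fun a b hab => ?_, j, by simp⟩
    by_cases ha : a = j
    · subst ha
      rw [Function.update_self]
      by_cases hb : b = j
      · rw [hb, Function.update_self]
      · rw [Function.update_of_ne hb]; exact (hall b).le
    · have hb : b ≠ j := fun h => ha (le_antisymm (h ▸ hab) (hj' a))
      rw [Function.update_of_ne ha, Function.update_of_ne hb]
      exact hs hab

/-- The algorithm LambdaDC with parameter `lam ∈ [0,1]`. -/
noncomputable def lambdaDC (k : ℕ) (lam : Set.Icc (0 : ℝ) 1) : OnlineAlgorithm k :=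
  .ofStep (fun C r p => ⟨lambdaDCMove lam C.1 r p, (lambdaDCMove_spec lam.2.1 C.2 r p).1⟩)
    fun C r p => (lambdaDCMove_spec lam.2.1 C.2 r p).2

/-- The consistency bound `α(k)`. -/
noncomputable def alpha (k : ℕ) (lam : ℝ) : ℝ :=
  if Odd k then 1 + ∑ i ∈ Finset.Icc 1 ((k - 1) / 2), 2 * lam ^ i
  else 1 + ∑ i ∈ Finset.Icc 1 (k / 2 - 1), 2 * lam ^ i + lam ^ (k / 2)

/-- The robustness bound `β(k)`, which is infinite for `lam = 0`. -/
noncomputable def beta (k : ℕ) (lam : ℝ) : ℝ≥0∞ :=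
  if lam = 0 then ⊤ else ENNReal.ofReal (∑ i ∈ Finset.range k, (lam ^ i)⁻¹)

/-! ### Sums and matchings -/

theorem sum_sub_sum_eq_of_eq_off_pair {ι : Type*} [Fintype ι] [DecidableEq ι] {f g : ι → ℝ}
    {i j : ι} (hij : i ≠ j) (h : ∀ a, a ≠ i → a ≠ j → f a = g a) :
    ∑ a, f a - ∑ a, g a = (f i - g i) + (f j - g j) := by
  rw [← Finset.sum_sub_distrib, ← Finset.sum_pair (f := fun a => f a - g a) hij]
  refine (Finset.sum_subset (Finset.subset_univ _) fun a _ ha => ?_).symm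
  simp only [Finset.mem_insert, Finset.mem_singleton, not_or] at ha
  exact sub_eq_zero.2 (h a ha.1 ha.2)

theorem sum_sub_sum_eq_of_eq_off {ι : Type*} [Fintype ι] {f g : ι → ℝ}
    {i : ι} (h : ∀ a, a ≠ i → f a = g a) :
    ∑ a, f a - ∑ a, g a = f i - g i := by
  rw [← Finset.sum_sub_distrib]
  exact Finset.sum_eq_single i (fun a _ ha => sub_eq_zero.2 (h a ha)) (by simp)

theorem moveCost_nonneg {k : ℕ} (s t : Fin k → ℝ) : 0 ≤ moveCost s t :=
  Finset.sum_nonneg fun _ _ => abs_nonneg _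

theorem moveCost_self {k : ℕ} (s : Fin k → ℝ) : moveCost s s = 0 := by simp [moveCost]

theorem abs_le_moveCost {k : ℕ} (s t : Fin k → ℝ) (i : Fin k) : |s i - t i| ≤ moveCost s t :=
  Finset.single_le_sum (f := fun i => |s i - t i|) (fun _ _ => abs_nonneg _) (Finset.mem_univ i)

theorem moveCost_comp_perm {k : ℕ} (s t : Fin k → ℝ) (π : Equiv.Perm (Fin k)) :
    moveCost (s ∘ π) (t ∘ π) = moveCost s t :=
  Equiv.sum_comp π fun i => |s i - t i|

theorem abs_sub_add_abs_sub_le_of_crossing {x y u v : ℝ} (hxy : x ≤ y) (huv : u ≤ v) :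
    |x - u| + |y - v| ≤ |x - v| + |y - u| := by
  rcases abs_cases (x - u) with h | h <;> rcases abs_cases (y - v) with h' | h' <;>
  rcases abs_cases (x - v) with h'' | h'' <;> rcases abs_cases (y - u) with h''' | h''' <;>
  linarith

theorem moveCost_comp_swap_le {k : ℕ} {s g : Fin k → ℝ} {i j : Fin k} (hs : s i ≤ s j)
    (hg : g j ≤ g i) : moveCost s (g ∘ Equiv.swap i j) ≤ moveCost s g := by
  by_cases hij : i = j
  · subst hij; simp
  have h := sum_sub_sum_eq_of_eq_off_pair (f := fun a => |s a - (g ∘ Equiv.swap i j) a|)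
    (g := fun a => |s a - g a|) hij fun a hi hj => by
      simp [Equiv.swap_apply_of_ne_of_ne hi hj]
  simp only [Function.comp_apply, Equiv.swap_apply_left, Equiv.swap_apply_right] at h
  have := abs_sub_add_abs_sub_le_of_crossing hs hg
  simp only [moveCost, Function.comp_apply]
  linarith

/-- Matching in sorted order is optimal. -/
theorem moveCost_comp_sort_le {k : ℕ} {s : Fin k → ℝ} (hs : Monotone s) (f : Fin k → ℝ) :
    moveCost s (f ∘ Tuple.sort f) ≤ moveCost s f :=
  Tuple.bubble_sort_induction (P := fun g => moveCost s g ≤ moveCost s f) le_rfl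
    fun _ _ _ hij hg h => (moveCost_comp_swap_le (hs hij.le) hg.le).trans h

theorem moveCost_comp_sort_le_comp_perm {k : ℕ} {s : Fin k → ℝ} (hs : Monotone s)
    (f : Fin k → ℝ) (π : Equiv.Perm (Fin k)) :
    moveCost s (f ∘ Tuple.sort f) ≤ moveCost s (f ∘ π) := by
  rw [← Tuple.comp_perm_comp_sort_eq_comp_sort (σ := π)]
  exact moveCost_comp_sort_le hs _

theorem moveCost_sort_sort_le {k : ℕ} (f g : Fin k → ℝ) :
    moveCost (f ∘ Tuple.sort f) (g ∘ Tuple.sort g) ≤ moveCost f g := by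
  rw [← moveCost_comp_perm f g (Tuple.sort f)]
  exact moveCost_comp_sort_le_comp_perm (Tuple.monotone_sort f) g _

theorem moveCost_update_le {k : ℕ} (s x : Fin k → ℝ) (p : Fin k) (r : ℝ) :
    moveCost s (Function.update x p r) ≤ moveCost s x + |x p - r| := by
  have h := sum_sub_sum_eq_of_eq_off (f := fun a => |s a - Function.update x p r a|)
    (g := fun a => |s a - x a|) (i := p) fun a ha => by simp [Function.update_of_ne ha]
  simp only [Function.update_self] at h
  have := abs_sub_le (s p) (x p) r
  simp only [moveCost]
  linarith

theorem abs_le_moveCost_sort_update {k : ℕ} (x : Fin k → ℝ) (p : Fin k) (r : ℝ) :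
    |x p - r| ≤
      moveCost x (Function.update x p r ∘ Tuple.sort (Function.update x p r)) := by
  set z := Function.update x p r with hz
  have h1 : ∑ a, x a - ∑ a, z a = x p - r := by
    rw [sum_sub_sum_eq_of_eq_off (i := p)] <;> simp +contextual [hz]
  have h2 : ∑ a, z a = ∑ a, (z ∘ Tuple.sort z) a := (Equiv.sum_comp (Tuple.sort z) z).symm
  rw [← h1, h2, ← Finset.sum_sub_distrib]
  exact Finset.abs_sum_le_sum_abs _ _

/-- After server `p ≤ i` of `x` has moved to `r`, servers can be relabelled without extra matching
cost such that label `i` is not to the left of `r`. -/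
theorem exists_perm_le {k : ℕ} {s : Fin k → ℝ} (hs : Monotone s) (x : Fin k → ℝ) {p i : Fin k}
    (hpi : p ≤ i) (r : ℝ) : ∃ π : Equiv.Perm (Fin k),
      moveCost s (Function.update x p r ∘ π) ≤ moveCost s x + |x p - r| ∧
      r ≤ (Function.update x p r ∘ π) i := by
  by_cases h : r ≤ Function.update x p r i
  · exact ⟨1, moveCost_update_le s x p r, h⟩
  · refine ⟨Equiv.swap p i, (moveCost_comp_swap_le (hs hpi) ?_).trans
      (moveCost_update_le s x p r), by simp⟩
    rw [Function.update_self]; exact (not_le.1 h).le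

theorem exists_perm_ge {k : ℕ} {s : Fin k → ℝ} (hs : Monotone s) (x : Fin k → ℝ) {p i : Fin k}
    (hpi : i ≤ p) (r : ℝ) : ∃ π : Equiv.Perm (Fin k),
      moveCost s (Function.update x p r ∘ π) ≤ moveCost s x + |x p - r| ∧
      (Function.update x p r ∘ π) i ≤ r := by
  by_cases h : Function.update x p r i ≤ r
  · exact ⟨1, moveCost_update_le s x p r, h⟩
  · refine ⟨Equiv.swap i p, (moveCost_comp_swap_le (hs hpi) ?_).trans
      (moveCost_update_le s x p r), by simp⟩
    rw [Function.update_self]; exact (not_le.1 h).le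

/-! ### The moves of LambdaDC -/

theorem lambdaDCMove_cases {k : ℕ} {lam : ℝ} (h0 : 0 ≤ lam) {s : Fin k → ℝ} (hs : Monotone s)
    (r : ℝ) (p : Fin k) :
    ((∃ i, s i = r) ∧ lambdaDCMove lam s r p = s) ∨
    (∃ i, (∀ a, a ≤ i) ∧ s i < r ∧ lambdaDCMove lam s r p = Function.update s i r) ∨
    (∃ i, (∀ a, i ≤ a) ∧ r < s i ∧ lambdaDCMove lam s r p = Function.update s i r) ∨
    ∃ i j : Fin k, ∃ u v : ℝ, i.1 + 1 = j.1 ∧ s i < r ∧ r < s j ∧ 0 ≤ u ∧ 0 ≤ v ∧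
      s i + u ≤ r ∧ r ≤ s j - v ∧ (s i + u = r ∨ s j - v = r) ∧
      (p ≤ i ∧ v = lam * u ∨ j ≤ p ∧ u = lam * v) ∧
      lambdaDCMove lam s r p =
        Function.update (Function.update s i (s i + u)) j (s j - v) := by
  classical
  by_cases hc : ∃ i, s i = r
  · exact Or.inl ⟨hc, by simp only [lambdaDCMove, if_pos hc]⟩
  have hne : ∀ a, s a < r ∨ r < s a := fun a => lt_or_gt_of_ne fun h => hc ⟨a, h⟩
  have memL : ∀ a, a ∈ leftOf s r ↔ s a < r := by simp [leftOf]
  have memR : ∀ a, a ∈ rightOf s r ↔ r < s a := by simp [rightOf]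
  right
  by_cases hL : (leftOf s r).Nonempty
  · have hi := (memL _).1 ((leftOf s r).max'_mem hL)
    have hi' : ∀ a, s a < r → a ≤ (leftOf s r).max' hL :=
      fun a ha => (leftOf s r).le_max' a ((memL a).2 ha)
    by_cases hR : (rightOf s r).Nonempty
    · right; right
      have hj := (memR _).1 ((rightOf s r).min'_mem hR)
      have hj' : ∀ a, r < s a → (rightOf s r).min' hR ≤ a :=
        fun a ha => (rightOf s r).min'_le a ((memR a).2 ha)
      have hm : lambdaDCMove lam s r p =
          if p ≤ (leftOf s r).max' hL then
            raceMove lam s r ((leftOf s r).max' hL) ((rightOf s r).min' hR)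
          else raceMove lam s r ((rightOf s r).min' hR) ((leftOf s r).max' hL) := by
        simp only [lambdaDCMove, if_neg hc, dif_pos hL, dif_pos hR]
      rw [hm]
      set i := (leftOf s r).max' hL
      set j := (rightOf s r).min' hR
      have hlt : i < j := lt_of_not_ge fun h => absurd (hs h) (by linarith)
      have hij : ∀ a, a ≤ i ∨ j ≤ a := fun a => (hne a).imp (hi' a) (hj' a)
      have hsucc : i.1 + 1 = j.1 := by
        have h1 : i.1 + 1 ≤ j.1 := hlt
        rcases hij ⟨i.1 + 1, h1.trans_lt j.2⟩ with h | h
        · have : i.1 + 1 ≤ i.1 := h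
          omega
        · have : j.1 ≤ i.1 + 1 := h
          omega
      obtain ⟨⟨a1, a2, a3, a4, a5⟩, b1, b2, b3, b4, b5⟩ := race_bounds h0 hi hj
      simp only [moveTowards, if_pos hi, if_neg (not_lt.2 hj.le)] at a1 a2 a3 a4 a5 b1 b2 b3 b4 b5
      split_ifs with hp
      · exact ⟨i, j, _, _, hsucc, hi, hj, by linarith, by linarith, a2, a3, a5, Or.inl ⟨hp, rfl⟩,
          by simp [raceMove, moveTowards, if_pos hi, if_neg (not_lt.2 hj.le)]⟩
      · refine ⟨i, j, _, _, hsucc, hi, hj, by linarith, by linarith, b2, b3, b5,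
          Or.inr ⟨(hij p).resolve_left hp, rfl⟩, ?_⟩
        rw [Function.update_comm hlt.ne]
        simp [raceMove, moveTowards, if_pos hi, if_neg (not_lt.2 hj.le)]
    · left
      refine ⟨_, fun a => hi' a ?_, hi,
        by simp only [lambdaDCMove, if_neg hc, dif_pos hL, dif_neg hR]⟩
      exact (hne a).resolve_right fun h => hR ⟨a, (memR a).2 h⟩
  · right; left
    have hall : ∀ a, r < s a := fun a =>
      (hne a).resolve_left fun h => hL ⟨a, (memL a).2 h⟩
    have hR : (rightOf s r).Nonempty := ⟨p, (memR p).2 (hall p)⟩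
    exact ⟨(rightOf s r).min' hR, fun a => (rightOf s r).min'_le a ((memR a).2 (hall a)), hall _,
      by simp only [lambdaDCMove, if_neg hc, dif_neg hL, dif_pos hR]⟩

/-! ### Potential functions -/

/-- Weighted matching between `s` and `x` plus a linear function of `s`. -/
noncomputable def potential {k : ℕ} (w c s x : Fin k → ℝ) : ℝ :=
  ∑ i, (w i * |s i - x i| + c i * s i)

theorem potential_const {k : ℕ} (w : ℝ) (c s x : Fin k → ℝ) :
    potential (fun _ => w) c s x = w * moveCost s x + ∑ i, c i * s i := by
  simp [potential, moveCost, Finset.sum_add_distrib, Finset.mul_sum]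

theorem potential_le_add {k : ℕ} {w c : Fin k → ℝ} {m : ℝ} (h0 : ∀ i, 0 ≤ w i)
    (hm : ∀ i, w i ≤ m) (s x y : Fin k → ℝ) :
    potential w c s y ≤ potential w c s x + m * moveCost x y := by
  simp only [potential, moveCost, Finset.mul_sum, ← Finset.sum_add_distrib]
  refine Finset.sum_le_sum fun i _ => ?_
  have h1 := mul_le_mul_of_nonneg_left (abs_sub_le (s i) (x i) (y i)) (h0 i)
  have h2 := mul_le_mul_of_nonneg_right (hm i) (abs_nonneg (x i - y i))
  linarith

theorem sum_mul_nonneg_of_antisymm {k : ℕ} {c s : Fin k → ℝ} (hc : Monotone c)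
    (hr : ∀ i, c i.rev = - c i) (hs : Monotone s) : 0 ≤ ∑ i, c i * s i := by
  rcases Nat.eq_zero_or_pos k with rfl | hk
  · simp
  have h0 : ∑ i, c i = 0 := by
    have h := Equiv.sum_comp Fin.revPerm c
    simp only [Fin.revPerm_apply, hr, Finset.sum_neg_distrib] at h
    linarith
  have h := (hc.monovary hs).sum_mul_sum_le_card_mul_sum
  rw [h0, zero_mul, Fintype.card_fin] at h
  have : (0 : ℝ) < k := by exact_mod_cast hk
  exact nonneg_of_mul_nonneg_right h this

theorem potential_nonneg {k : ℕ} {w c : Fin k → ℝ} (hw : ∀ i, 0 ≤ w i) (hc : Monotone c)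
    (hr : ∀ i, c i.rev = - c i) {s : Fin k → ℝ} (hs : Monotone s) (x : Fin k → ℝ) :
    0 ≤ potential w c s x := by
  rw [potential, Finset.sum_add_distrib]
  exact add_nonneg (Finset.sum_nonneg fun i _ => mul_nonneg (hw i) (abs_nonneg _))
    (sum_mul_nonneg_of_antisymm hc hr hs)

theorem moveCost_add_potential_update_right {k : ℕ} {w c s x : Fin k → ℝ} {i : Fin k} {r : ℝ}
    (h1 : 1 + c i ≤ w i) (hr : s i ≤ r) (hx : r ≤ x i) :
    moveCost s (Function.update s i r) + potential w c (Function.update s i r) x ≤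
      potential w c s x := by
  have h := sum_sub_sum_eq_of_eq_off (i := i)
    (f := fun a => |s a - Function.update s i r a| +
      (w a * |Function.update s i r a - x a| + c a * Function.update s i r a))
    (g := fun a => w a * |s a - x a| + c a * s a) fun a ha => by simp [Function.update_of_ne ha]
  simp only [Function.update_self, Finset.sum_add_distrib] at h
  rw [abs_of_nonpos (sub_nonpos.2 hr), abs_of_nonpos (sub_nonpos.2 hx),
    abs_of_nonpos (sub_nonpos.2 (hr.trans hx))] at h
  simp only [potential, moveCost, Finset.sum_add_distrib]
  nlinarith [mul_le_mul_of_nonneg_right h1 (sub_nonneg.2 hr)]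

theorem moveCost_add_potential_update_left {k : ℕ} {w c s x : Fin k → ℝ} {i : Fin k} {r : ℝ}
    (h1 : 1 ≤ w i + c i) (hr : r ≤ s i) (hx : x i ≤ r) :
    moveCost s (Function.update s i r) + potential w c (Function.update s i r) x ≤
      potential w c s x := by
  have h := sum_sub_sum_eq_of_eq_off (i := i)
    (f := fun a => |s a - Function.update s i r a| +
      (w a * |Function.update s i r a - x a| + c a * Function.update s i r a))
    (g := fun a => w a * |s a - x a| + c a * s a) fun a ha => by simp [Function.update_of_ne ha]
  simp only [Function.update_self, Finset.sum_add_distrib] at h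
  rw [abs_of_nonneg (sub_nonneg.2 hr), abs_of_nonneg (sub_nonneg.2 hx),
    abs_of_nonneg (sub_nonneg.2 (hx.trans hr))] at h
  simp only [potential, moveCost, Finset.sum_add_distrib]
  nlinarith [mul_le_mul_of_nonneg_right h1 (sub_nonneg.2 hr)]

theorem moveCost_add_potential_race {k : ℕ} {w c s x : Fin k → ℝ} {i j : Fin k} {u v : ℝ}
    (hij : i ≠ j) (hu : 0 ≤ u) (hv : 0 ≤ v) (hwi : 0 ≤ w i) (hwj : 0 ≤ w j)
    (h : s i + u ≤ x i ∧ u + v + v * (w j - c j) ≤ u * (w i - c i) ∨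
      x j ≤ s j - v ∧ u + v + u * (w i + c i) ≤ v * (w j + c j)) :
    moveCost s (Function.update (Function.update s i (s i + u)) j (s j - v)) +
      potential w c (Function.update (Function.update s i (s i + u)) j (s j - v)) x ≤
      potential w c s x := by
  set t := Function.update (Function.update s i (s i + u)) j (s j - v) with ht
  have ti : t i = s i + u := by simp [ht, Function.update_of_ne hij]
  have tj : t j = s j - v := by simp [ht]
  have hsum := sum_sub_sum_eq_of_eq_off_pair hij
    (f := fun a => |s a - t a| + (w a * |t a - x a| + c a * t a))
    (g := fun a => w a * |s a - x a| + c a * s a) fun a hi hj => by simp [ht, hi, hj]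
  simp only [ti, tj, Finset.sum_add_distrib] at hsum
  rw [show s i - (s i + u) = -u by ring, show s j - (s j - v) = v by ring, abs_neg,
    abs_of_nonneg hu, abs_of_nonneg hv] at hsum
  simp only [potential, moveCost, Finset.sum_add_distrib]
  rcases h with ⟨hx, h⟩ | ⟨hx, h⟩
  · rw [abs_of_nonpos (sub_nonpos.2 hx), abs_of_nonpos (by linarith : s i - x i ≤ 0)] at hsum
    have : |s j - v - x j| ≤ |s j - x j| + v := by
      have := abs_sub (s j - x j) v
      rwa [abs_of_nonneg hv, sub_right_comm] at this
    nlinarith [mul_le_mul_of_nonneg_left this hwj]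
  · rw [abs_of_nonneg (sub_nonneg.2 hx), abs_of_nonneg (by linarith : 0 ≤ s j - x j)] at hsum
    have : |s i + u - x i| ≤ |s i - x i| + u := by
      have := abs_add_le (s i - x i) u
      rwa [abs_of_nonneg hu, sub_add_eq_add_sub] at this
    nlinarith [mul_le_mul_of_nonneg_left this hwi]

/-! ### Coefficients of the potential functions -/

/-- `1 + 2 μ + 2 μ² + ⋯ + 2 μⁿ` -/
noncomputable def geomBound (μ : ℝ) (n : ℕ) : ℝ := 2 * ∑ i ∈ Finset.range (n + 1), μ ^ i - 1

theorem geomBound_zero (μ : ℝ) : geomBound μ 0 = 1 := by norm_num [geomBound]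

theorem geomBound_succ (μ : ℝ) (n : ℕ) :
    geomBound μ (n + 1) = geomBound μ n + 2 * μ ^ (n + 1) := by
  rw [geomBound, geomBound, Finset.sum_range_succ]; ring

theorem geomBound_succ_eq_mul (μ : ℝ) (n : ℕ) :
    geomBound μ (n + 1) = μ * geomBound μ n + μ + 1 := by
  induction n with
  | zero => rw [geomBound_succ, geomBound_zero]; ring
  | succ n ih =>
    rw [geomBound_succ μ (n + 1)]
    linear_combination ih - μ * geomBound_succ μ n

theorem geomBound_mono {μ : ℝ} (h0 : 0 ≤ μ) : Monotone (geomBound μ) :=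
  monotone_nat_of_le_succ fun n => by
    rw [geomBound_succ]
    have := pow_nonneg h0 (n + 1)
    linarith

theorem one_le_geomBound {μ : ℝ} (h0 : 0 ≤ μ) (n : ℕ) : 1 ≤ geomBound μ n := by
  rw [← geomBound_zero μ]; exact geomBound_mono h0 n.zero_le

theorem two_mul_alpha {k : ℕ} (hk : 1 ≤ k) (lam : ℝ) :
    2 * alpha k lam = geomBound lam ((k - 1) / 2) + geomBound lam (k / 2) := by
  have key : ∀ n, 1 + ∑ i ∈ Finset.Icc 1 n, 2 * lam ^ i = geomBound lam n := by
    intro n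
    induction n with
    | zero => simp [geomBound_zero]
    | succ n ih => rw [Finset.sum_Icc_succ_top (by omega), ← add_assoc, ih, geomBound_succ]
  unfold alpha
  split_ifs with h
  · obtain ⟨m, rfl⟩ := h
    rw [key, show (2 * m + 1 - 1) / 2 = m by omega, show (2 * m + 1) / 2 = m by omega]
    ring
  · obtain ⟨m, rfl⟩ := Nat.not_odd_iff_even.1 h
    obtain ⟨n, rfl⟩ : ∃ n, m = n + 1 := ⟨m - 1, by omega⟩
    rw [key, show (n + 1 + (n + 1) - 1) / 2 = n by omega,
      show (n + 1 + (n + 1)) / 2 = n + 1 by omega, geomBound_succ, Nat.add_sub_cancel]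
    ring

theorem one_le_alpha {k : ℕ} (hk : 1 ≤ k) {lam : ℝ} (h0 : 0 ≤ lam) : 1 ≤ alpha k lam := by
  linarith [two_mul_alpha hk lam, one_le_geomBound h0 ((k - 1) / 2),
    one_le_geomBound h0 (k / 2)]

/-- Coefficients of the linear part of the potential function for the consistency bound. -/
noncomputable def consCoeff (k : ℕ) (lam : ℝ) (i : Fin k) : ℝ :=
  if 2 * i.1 + 1 ≤ k then geomBound lam i - alpha k lam
  else alpha k lam - geomBound lam (k - 1 - i)

theorem consCoeff_rev {k : ℕ} (lam : ℝ) (i : Fin k) :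
    consCoeff k lam i.rev = - consCoeff k lam i := by
  have hi := i.2
  have hα := two_mul_alpha (by omega : 1 ≤ k) lam
  have hr : i.rev.1 = k - 1 - i.1 := by rw [Fin.val_rev]; omega
  unfold consCoeff
  rw [hr]
  split_ifs with h1 h2 h2
  · rw [show (k - 1) / 2 = i.1 by omega, show k / 2 = i.1 by omega] at hα
    rw [show k - 1 - i.1 = i.1 by omega]
    linarith
  · ring
  · rw [show k - 1 - (k - 1 - i.1) = i.1 by omega]; ring
  · omega

theorem consCoeff_first {k : ℕ} (lam : ℝ) (i : Fin k) (hi : ∀ a, i ≤ a) :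
    alpha k lam + consCoeff k lam i = 1 := by
  have h0 : i.1 = 0 := Nat.le_zero.1 (hi ⟨0, by have := i.2; omega⟩)
  have := i.2
  rw [consCoeff, if_pos (by omega), h0, geomBound_zero]
  ring

theorem consCoeff_last {k : ℕ} (lam : ℝ) (i : Fin k) (hi : ∀ a, a ≤ i) :
    alpha k lam - consCoeff k lam i = 1 := by
  have h := consCoeff_first lam i.rev fun a => by rw [Fin.rev_le_iff]; exact hi _
  rw [consCoeff_rev] at h
  linarith

theorem consCoeff_succ {k : ℕ} {lam : ℝ} (h0 : 0 ≤ lam) (h1 : lam ≤ 1) {i j : Fin k}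
    (hij : i.1 + 1 = j.1) :
    1 + lam + lam * (alpha k lam + consCoeff k lam i) ≤ alpha k lam + consCoeff k lam j := by
  have hj := j.2
  have hα := two_mul_alpha (by omega : 1 ≤ k) lam
  unfold consCoeff
  rw [← hij] at *
  have hpow : ∀ a b : ℕ, a ≤ b → lam ^ b ≤ lam ^ a := fun a b h => pow_le_pow_of_le_one h0 h1 h
  split_ifs with h2 h3 h3
  · linarith [geomBound_succ_eq_mul lam i.1]
  · rcases (by omega : k = 2 * i.1 + 2 ∨ k = 2 * i.1 + 1) with h | h
    · rw [show (k - 1) / 2 = i.1 by omega, show k / 2 = i.1 + 1 by omega] at hα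
      rw [show k - 1 - (i.1 + 1) = i.1 by omega]
      linarith [geomBound_succ_eq_mul lam i.1]
    · obtain ⟨n, hn⟩ : ∃ n, i.1 = n + 1 := ⟨i.1 - 1, by omega⟩
      rw [show (k - 1) / 2 = n + 1 by omega, show k / 2 = n + 1 by omega] at hα
      rw [show k - 1 - (i.1 + 1) = n by omega, hn]
      linarith [geomBound_succ_eq_mul lam (n + 1), geomBound_succ lam n,
        geomBound_succ lam (n + 1), hpow (n + 1) (n + 1 + 1) (by omega)]
  · omega
  · obtain ⟨n, hn⟩ : ∃ n, k - 1 - (i.1 + 1) = n := ⟨_, rfl⟩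
    rw [hn, show k - 1 - i.1 = n + 1 by omega]
    have e1 := geomBound_succ_eq_mul lam ((k - 1) / 2)
    have e2 := geomBound_succ_eq_mul lam (k / 2)
    have e3 := congrArg (lam * ·) hα
    have e4 := hpow (n + 1) ((k - 1) / 2 + 1) (by omega)
    have e5 := hpow (n + 1 + 1) (k / 2 + 1) (by omega)
    simp only [mul_add] at e3
    linarith [geomBound_succ_eq_mul lam (n + 1), geomBound_succ lam n,
      geomBound_succ lam (n + 1), geomBound_succ lam ((k - 1) / 2), geomBound_succ lam (k / 2)]

theorem consCoeff_pred {k : ℕ} {lam : ℝ} (h0 : 0 ≤ lam) (h1 : lam ≤ 1) {i j : Fin k}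
    (hij : i.1 + 1 = j.1) :
    1 + lam + lam * (alpha k lam - consCoeff k lam j) ≤ alpha k lam - consCoeff k lam i := by
  have h := consCoeff_succ h0 h1 (i := j.rev) (j := i.rev) (by
    rw [Fin.val_rev, Fin.val_rev]; have := j.2; omega)
  rwa [consCoeff_rev, consCoeff_rev, ← sub_eq_add_neg, ← sub_eq_add_neg] at h

theorem consCoeff_mono {k : ℕ} {lam : ℝ} (h0 : 0 ≤ lam) : Monotone (consCoeff k lam) := by
  intro i j hij
  have hij' : i.1 ≤ j.1 := hij
  have hj := j.2
  have hα := two_mul_alpha (by omega : 1 ≤ k) lam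
  have hm := geomBound_mono h0
  unfold consCoeff
  split_ifs with h2 h3 h3
  · linarith [hm hij']
  · linarith [hm (by omega : i.1 ≤ (k - 1) / 2), hm (by omega : k - 1 - j.1 ≤ k / 2)]
  · omega
  · linarith [hm (by omega : k - 1 - j.1 ≤ k - 1 - i.1)]

/-- Matching weights of the potential function for the robustness bound. -/
noncomputable def robWeight (k : ℕ) (lam : ℝ) (i : Fin k) : ℝ :=
  (geomBound lam⁻¹ i + geomBound lam⁻¹ i.rev) / 2

/-- Coefficients of the linear part of the potential function for the robustness bound. -/
noncomputable def robCoeff (k : ℕ) (lam : ℝ) (i : Fin k) : ℝ :=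
  (geomBound lam⁻¹ i - geomBound lam⁻¹ i.rev) / 2

theorem robWeight_add (k : ℕ) (lam : ℝ) (i : Fin k) :
    robWeight k lam i + robCoeff k lam i = geomBound lam⁻¹ i := by
  unfold robWeight robCoeff; ring

theorem robWeight_sub (k : ℕ) (lam : ℝ) (i : Fin k) :
    robWeight k lam i - robCoeff k lam i = geomBound lam⁻¹ i.rev := by
  unfold robWeight robCoeff; ring

theorem robCoeff_rev {k : ℕ} (lam : ℝ) (i : Fin k) :
    robCoeff k lam i.rev = - robCoeff k lam i := by
  unfold robCoeff; rw [Fin.rev_rev]; ring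

theorem robCoeff_mono {k : ℕ} {lam : ℝ} (h0 : 0 ≤ lam) : Monotone (robCoeff k lam) := by
  intro i j hij
  have h1 := geomBound_mono (inv_nonneg.2 h0) hij
  have h2 := geomBound_mono (inv_nonneg.2 h0) (Fin.rev_le_rev.2 hij)
  unfold robCoeff
  linarith

theorem robWeight_nonneg {k : ℕ} {lam : ℝ} (h0 : 0 ≤ lam) (i : Fin k) : 0 ≤ robWeight k lam i := by
  unfold robWeight
  linarith [one_le_geomBound (inv_nonneg.2 h0) i, one_le_geomBound (inv_nonneg.2 h0) i.rev]

theorem robWeight_le {k : ℕ} {lam : ℝ} (h0 : 0 < lam) (h1 : lam ≤ 1) (i : Fin k) :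
    robWeight k lam i ≤ ∑ i ∈ Finset.range k, (lam ^ i)⁻¹ := by
  have hμ := (one_le_inv₀ h0).2 h1
  simp only [← inv_pow]
  rw [robWeight]
  generalize lam⁻¹ = μ at *
  have hi : k = i.1 + 1 + i.rev.1 := by rw [Fin.val_rev]; have := i.2; omega
  have h : ∑ a ∈ Finset.range i.rev.1, μ ^ (a + 1) ≤
      ∑ a ∈ Finset.range i.rev.1, μ ^ (i.1 + 1 + a) :=
    Finset.sum_le_sum fun a _ => pow_le_pow_right₀ hμ (by omega)
  have hk := Finset.sum_range_add (fun a => μ ^ a) (i.1 + 1) i.rev.1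
  rw [← hi] at hk
  rw [geomBound, geomBound, hk, Finset.sum_range_succ' _ i.rev.1]
  linarith [pow_zero μ]

theorem geomBound_inv_succ {lam : ℝ} (h0 : 0 < lam) (n : ℕ) :
    lam * geomBound lam⁻¹ (n + 1) = geomBound lam⁻¹ n + 1 + lam := by
  rw [geomBound_succ_eq_mul]; field_simp

theorem le_geomBound_inv_succ {lam : ℝ} (h0 : 0 < lam) (h1 : lam ≤ 1) (n : ℕ) :
    lam * geomBound lam⁻¹ n + 1 + lam ≤ geomBound lam⁻¹ (n + 1) := by
  have hμ := (one_le_inv₀ h0).2 h1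
  have := one_le_geomBound (inv_nonneg.2 h0.le) n
  rw [geomBound_succ_eq_mul]
  nlinarith [mul_le_mul_of_nonneg_right (h1.trans hμ) (by linarith : 0 ≤ geomBound lam⁻¹ n)]

/-! ### Amortized cost of one request -/

theorem lambdaDCMove_robust {k : ℕ} {lam : ℝ} (h0 : 0 < lam) (h1 : lam ≤ 1) {s x : Fin k → ℝ}
    (hs : Monotone s) (hx : Monotone x) (r : ℝ) (p : Fin k) (hr : ∃ l, x l = r) :
    moveCost s (lambdaDCMove lam s r p) +
      potential (robWeight k lam) (robCoeff k lam) (lambdaDCMove lam s r p) x ≤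
      potential (robWeight k lam) (robCoeff k lam) s x := by
  obtain ⟨l, hl⟩ := hr
  have hμ := inv_nonneg.2 h0.le
  rcases lambdaDCMove_cases h0.le hs r p with ⟨-, h⟩ | ⟨i, hi, hir, h⟩ | ⟨i, hi, hir, h⟩ |
    ⟨i, j, u, v, hij, -, -, hu, hv, hur, hvr, -, hp, h⟩ <;> rw [h]
  · rw [moveCost_self, zero_add]
  · refine moveCost_add_potential_update_right ?_ hir.le (hl ▸ hx (hi l))
    linarith [robWeight_sub k lam i, one_le_geomBound hμ i.rev]
  · refine moveCost_add_potential_update_left ?_ hir.le (hl ▸ hx (hi l))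
    linarith [robWeight_add k lam i, one_le_geomBound hμ i]
  · refine moveCost_add_potential_race (by rintro rfl; omega) hu hv (robWeight_nonneg h0.le i)
      (robWeight_nonneg h0.le j) ?_
    have hrev : i.rev.1 = j.rev.1 + 1 := by rw [Fin.val_rev, Fin.val_rev]; have := j.2; omega
    simp only [robWeight_add, robWeight_sub, hrev, ← hij]
    rcases le_or_gt l i with hli | hli
    · left
      refine ⟨hur.trans (hl ▸ hx hli), ?_⟩
      rcases hp with ⟨-, rfl⟩ | ⟨-, rfl⟩
      · nlinarith [mul_le_mul_of_nonneg_left (le_geomBound_inv_succ h0 h1 j.rev) hu]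
      · nlinarith [congrArg (v * ·) (geomBound_inv_succ h0 j.rev)]
    · right
      have hli : j ≤ l := by rw [Fin.le_def, ← hij]; exact hli
      refine ⟨(hx hli).trans (hl ▸ hvr), ?_⟩
      rcases hp with ⟨-, rfl⟩ | ⟨-, rfl⟩
      · nlinarith [congrArg (u * ·) (geomBound_inv_succ h0 i)]
      · nlinarith [mul_le_mul_of_nonneg_left (le_geomBound_inv_succ h0 h1 i) hv]

/-- The potential function for the consistency bound. -/
noncomputable abbrev consPotential (k : ℕ) (lam : ℝ) (s x : Fin k → ℝ) : ℝ :=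
  potential (fun _ => alpha k lam) (consCoeff k lam) s x

theorem consPotential_nonneg {k : ℕ} (hk : 1 ≤ k) {lam : ℝ} (h0 : 0 ≤ lam) {s : Fin k → ℝ}
    (hs : Monotone s) (x : Fin k → ℝ) : 0 ≤ consPotential k lam s x :=
  potential_nonneg (fun _ => zero_le_one.trans (one_le_alpha hk h0)) (consCoeff_mono h0)
    (consCoeff_rev lam) hs x

theorem lambdaDCMove_consistent {k : ℕ} {lam : ℝ} (h0 : 0 ≤ lam) (h1 : lam ≤ 1)
    {s : Fin k → ℝ} (hs : Monotone s) (x : Fin k → ℝ) (r : ℝ) (p : Fin k) :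
    moveCost s (lambdaDCMove lam s r p) + consPotential k lam (lambdaDCMove lam s r p)
        (Function.update x p r ∘ Tuple.sort (Function.update x p r)) ≤
      consPotential k lam s x + alpha k lam * |x p - r| := by
  have hα := zero_le_one.trans (one_le_alpha p.pos h0)
  suffices h : ∃ π : Equiv.Perm (Fin k),
      moveCost s (Function.update x p r ∘ π) ≤ moveCost s x + |x p - r| ∧
      moveCost s (lambdaDCMove lam s r p) + consPotential k lam (lambdaDCMove lam s r p)
        (Function.update x p r ∘ π) ≤ consPotential k lam s (Function.update x p r ∘ π) by
    obtain ⟨π, h2, h3⟩ := h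
    have h4 := mul_le_mul_of_nonneg_left (moveCost_comp_sort_le_comp_perm
      (lambdaDCMove_spec h0 hs r p).1 (Function.update x p r) π) hα
    have h5 := mul_le_mul_of_nonneg_left h2 hα
    simp only [consPotential, potential_const] at h3 ⊢
    linarith
  rcases lambdaDCMove_cases h0 hs r p with ⟨-, h⟩ | ⟨i, hi, hir, h⟩ | ⟨i, hi, hir, h⟩ |
    ⟨i, j, u, v, hij, -, -, hu, hv, hur, hvr, -, hp, h⟩ <;> rw [h]
  · refine ⟨1, moveCost_update_le s x p r, ?_⟩
    rw [moveCost_self, zero_add]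
  · obtain ⟨π, h2, h3⟩ := exists_perm_le hs x (hi p) r
    refine ⟨π, h2, moveCost_add_potential_update_right ?_ hir.le h3⟩
    linarith [consCoeff_last lam i hi]
  · obtain ⟨π, h2, h3⟩ := exists_perm_ge hs x (hi p) r
    refine ⟨π, h2, moveCost_add_potential_update_left ?_ hir.le h3⟩
    linarith [consCoeff_first lam i hi]
  · have hne : i ≠ j := by rintro rfl; omega
    rcases hp with ⟨hp, rfl⟩ | ⟨hp, rfl⟩
    · obtain ⟨π, h2, h3⟩ := exists_perm_le hs x hp r
      refine ⟨π, h2, moveCost_add_potential_race hne hu hv hα hα (.inl ⟨hur.trans h3, ?_⟩)⟩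
      nlinarith [mul_le_mul_of_nonneg_left (consCoeff_pred h0 h1 hij) hu]
    · obtain ⟨π, h2, h3⟩ := exists_perm_ge hs x hp r
      refine ⟨π, h2, moveCost_add_potential_race hne hu hv hα hα (.inr ⟨h3.trans hvr, ?_⟩)⟩
      nlinarith [mul_le_mul_of_nonneg_left (consCoeff_succ h0 h1 hij) hv]

/-- A request at the `p`-th point of `x` with prediction `p`. -/
theorem lambdaDCMove_consPotential_le {k : ℕ} {lam : ℝ} (h0 : 0 ≤ lam) (h1 : lam ≤ 1)
    {s x : Fin k → ℝ} (hs : Monotone s) (hx : Monotone x) (p : Fin k) :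
    moveCost s (lambdaDCMove lam s (x p) p) +
      consPotential k lam (lambdaDCMove lam s (x p) p) x ≤ consPotential k lam s x := by
  have h := lambdaDCMove_consistent h0 h1 hs x (x p) p
  rwa [Function.update_eq_self, (Tuple.sort_eq_refl_iff_monotone).2 hx, sub_self, abs_zero,
    mul_zero, add_zero] at h

/-! ### Amortized cost of a sequence of requests -/

theorem scheduleCost_succ {k : ℕ} (S : ℕ → Fin k → ℝ) (n : ℕ) :
    scheduleCost S (n + 1) = moveCost (S 0) (S 1) + scheduleCost (fun t => S (t + 1)) n := by
  rw [scheduleCost, Finset.sum_range_succ', add_comm]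
  rfl

theorem scheduleCost_nonneg {k : ℕ} (S : ℕ → Fin k → ℝ) (n : ℕ) : 0 ≤ scheduleCost S n :=
  Finset.sum_nonneg fun _ _ => moveCost_nonneg _ _

theorem OnlineAlgorithm.cost_ofStep_nil {k : ℕ} (step : Config k → ℝ → Fin k → Config k)
    (h : ∀ C r p, ∃ i, (step C r p).1 i = r) (C : Config k) :
    (OnlineAlgorithm.ofStep step h).cost C [] = 0 := by
  simp [OnlineAlgorithm.cost, scheduleCost]

theorem OnlineAlgorithm.cost_ofStep_cons {k : ℕ} (step : Config k → ℝ → Fin k → Config k)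
    (h : ∀ C r p, ∃ i, (step C r p).1 i = r) (C : Config k) (r : ℝ) (p : Fin k)
    (σ : List (ℝ × Fin k)) :
    (OnlineAlgorithm.ofStep step h).cost C ((r, p) :: σ) =
      moveCost C.1 (step C r p).1 + (OnlineAlgorithm.ofStep step h).cost (step C r p) σ := by
  rw [OnlineAlgorithm.cost, List.length_cons, scheduleCost_succ]
  rfl

theorem lambdaDC_cost_le_of_sorted {k : ℕ} (lam : Set.Icc (0 : ℝ) 1) (h0 : 0 < lam.1)
    (σ : List (ℝ × Fin k)) : ∀ (C : Config k) (S : ℕ → Fin k → ℝ), (∀ t, Monotone (S t)) →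
      (∀ (t : ℕ) (ht : t < σ.length), ∃ i, S (t + 1) i = σ[t].1) →
      (lambdaDC k lam).cost C σ ≤
        (∑ i ∈ Finset.range k, (lam.1 ^ i)⁻¹) * scheduleCost S σ.length +
          potential (robWeight k lam) (robCoeff k lam) C.1 (S 0) := by
  induction σ with
  | nil =>
    intro C S _ _
    rw [lambdaDC, OnlineAlgorithm.cost_ofStep_nil]
    simpa [scheduleCost] using potential_nonneg (robWeight_nonneg h0.le) (robCoeff_mono h0.le)
      (robCoeff_rev lam.1) C.2 (S 0)
  | cons q σ ih =>
    obtain ⟨r, p⟩ := q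
    intro C S hS hr
    have h1 := ih ⟨_, (lambdaDCMove_spec lam.2.1 C.2 r p).1⟩ (fun t => S (t + 1))
      (fun t => hS _) fun t ht => hr (t + 1) (by simpa using ht)
    have h2 := lambdaDCMove_robust h0 lam.2.2 C.2 (hS 1) r p (hr 0 (by simp))
    have h3 := potential_le_add (c := robCoeff k lam) (robWeight_nonneg h0.le)
      (robWeight_le h0 lam.2.2) C.1 (S 0) (S 1)
    rw [lambdaDC, OnlineAlgorithm.cost_ofStep_cons, List.length_cons, scheduleCost_succ, mul_add]
    simp only [lambdaDC, zero_add] at h1 ⊢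
    linarith

theorem lambdaDC_cost_le_of_schedule {k : ℕ} (lam : Set.Icc (0 : ℝ) 1) (h0 : 0 < lam.1)
    (C : Config k) (σ : List (ℝ × Fin k)) {S : ℕ → Fin k → ℝ}
    (hS : IsSchedule C (σ.map Prod.fst) S) :
    (lambdaDC k lam).cost C σ ≤
      (∑ i ∈ Finset.range k, (lam.1 ^ i)⁻¹) * scheduleCost S σ.length +
        potential (robWeight k lam) (robCoeff k lam) C.1 C.1 := by
  have h := lambdaDC_cost_le_of_sorted lam h0 σ C (fun t => S t ∘ Tuple.sort (S t))
    (fun t => Tuple.monotone_sort _) fun t ht => by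
      obtain ⟨i, hi⟩ := hS.2 t (by simpa using ht)
      exact ⟨(Tuple.sort (S (t + 1))).symm i, by simpa using hi⟩
  simp only [hS.1, Tuple.sort_eq_refl_iff_monotone.2 C.2, Equiv.coe_refl, Function.comp_id] at h
  refine h.trans (add_le_add_left (mul_le_mul_of_nonneg_left ?_ ?_) _)
  · exact Finset.sum_le_sum fun t _ => moveCost_sort_sort_le _ _
  · exact Finset.sum_nonneg fun i _ => inv_nonneg.2 (pow_nonneg h0.le i)

theorem exists_isSchedule {k : ℕ} (hk : 1 ≤ k) (C : Config k) (rs : List ℝ) :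
    {c : ℝ | ∃ S : ℕ → Fin k → ℝ, IsSchedule C rs S ∧ c = scheduleCost S rs.length}.Nonempty :=
  ⟨_, fun t => Nat.casesOn t C.1 fun n _ => rs.getD n 0,
    ⟨rfl, fun t ht => ⟨⟨0, hk⟩, by simp [ht]⟩⟩, rfl⟩

theorem opt_nonneg {k : ℕ} (C : Config k) (rs : List ℝ) : 0 ≤ opt C rs :=
  Real.sInf_nonneg fun _ ⟨S, _, h⟩ => h ▸ scheduleCost_nonneg S _

theorem lambdaDC_cost_le_opt {k : ℕ} (hk : 1 ≤ k) (lam : Set.Icc (0 : ℝ) 1) (h0 : 0 < lam.1)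
    (C : Config k) (σ : List (ℝ × Fin k)) :
    (lambdaDC k lam).cost C σ ≤
      (∑ i ∈ Finset.range k, (lam.1 ^ i)⁻¹) * opt C (σ.map Prod.fst) +
        potential (robWeight k lam) (robCoeff k lam) C.1 C.1 := by
  have hβ : 0 < ∑ i ∈ Finset.range k, (lam.1 ^ i)⁻¹ :=
    Finset.sum_pos (fun i _ => inv_pos.2 (pow_pos h0 i)) ⟨0, Finset.mem_range.2 hk⟩
  rw [← sub_le_iff_le_add, ← div_le_iff₀' hβ]
  refine le_csInf (exists_isSchedule hk C _) ?_
  rintro _ ⟨S, hS, rfl⟩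
  rw [div_le_iff₀' hβ, sub_le_iff_le_add, List.length_map]
  exact lambdaDC_cost_le_of_schedule lam h0 C σ hS

theorem lambdaDC_cost_le_ftp {k : ℕ} (hk : 1 ≤ k) (lam : Set.Icc (0 : ℝ) 1)
    (σ : List (ℝ × Fin k)) : ∀ C X : Config k,
      (lambdaDC k lam).cost C σ ≤
        alpha k lam * (ftp k).cost X σ + consPotential k lam C.1 X.1 := by
  induction σ with
  | nil =>
    intro C X
    rw [lambdaDC, ftp, OnlineAlgorithm.cost_ofStep_nil, OnlineAlgorithm.cost_ofStep_nil, mul_zero,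
      zero_add]
    exact consPotential_nonneg hk lam.2.1 C.2 _
  | cons q σ ih =>
    obtain ⟨r, p⟩ := q
    intro C X
    have h1 := ih ⟨_, (lambdaDCMove_spec lam.2.1 C.2 r p).1⟩ (ftpStep X r p)
    have h2 := lambdaDCMove_consistent lam.2.1 lam.2.2 C.2 X.1 r p
    have h3 := mul_le_mul_of_nonneg_left (abs_le_moveCost_sort_update X.1 p r)
      (zero_le_one.trans (one_le_alpha hk lam.2.1))
    rw [lambdaDC, ftp, OnlineAlgorithm.cost_ofStep_cons, OnlineAlgorithm.cost_ofStep_cons, mul_add]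
    simp only [lambdaDC, ftp, ftpStep] at h1 ⊢
    linarith

/-! ### Instances of optimal cost zero -/

theorem abs_sub_le_scheduleCost {k : ℕ} (S : ℕ → Fin k → ℝ) {t n : ℕ} (h : t ≤ n) (i : Fin k) :
    |S 0 i - S t i| ≤ scheduleCost S n := by
  have hmono : scheduleCost S t ≤ scheduleCost S n :=
    Finset.sum_le_sum_of_subset_of_nonneg (Finset.range_mono h) fun _ _ _ => moveCost_nonneg _ _
  refine le_trans ?_ hmono
  clear h hmono
  induction t with
  | zero => simp [scheduleCost]
  | succ t ih =>
    rw [scheduleCost, Finset.sum_range_succ]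
    exact (abs_sub_le _ (S t i) _).trans (add_le_add ih (abs_le_moveCost _ _ i))

theorem exists_eq_of_opt_eq_zero {k : ℕ} (hk : 1 ≤ k) {C : Config k} {rs : List ℝ}
    (h : opt C rs = 0) {r : ℝ} (hr : r ∈ rs) : ∃ i, C.1 i = r := by
  by_contra! hne
  have : Nonempty (Fin k) := ⟨⟨0, hk⟩⟩
  obtain ⟨i, hi⟩ := Finite.exists_min fun i => |C.1 i - r|
  have hpos : opt C rs < |C.1 i - r| := h ▸ abs_pos.2 (sub_ne_zero.2 (hne i))
  obtain ⟨_, ⟨S, hS, rfl⟩, hlt⟩ := exists_lt_of_csInf_lt (exists_isSchedule hk C rs) hpos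
  obtain ⟨t, ht, rfl⟩ := List.getElem_of_mem hr
  obtain ⟨j, hj⟩ := hS.2 t ht
  have h1 := abs_sub_le_scheduleCost S (Nat.succ_le_of_lt ht) j
  rw [hS.1, Nat.succ_eq_add_one, hj] at h1
  linarith [hi j]

theorem lambdaDC_cost_eq_zero {k : ℕ} (lam : Set.Icc (0 : ℝ) 1) (C : Config k)
    {σ : List (ℝ × Fin k)} (h : ∀ r ∈ σ.map Prod.fst, ∃ i, C.1 i = r) :
    (lambdaDC k lam).cost C σ = 0 := by
  induction σ with
  | nil => exact OnlineAlgorithm.cost_ofStep_nil _ _ _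
  | cons q σ ih =>
    obtain ⟨r, p⟩ := q
    have hm : lambdaDCMove lam C.1 r p = C.1 := by
      rw [lambdaDCMove, if_pos (h r (by simp))]
    have ih := ih fun r hr => h r (by simp only [List.map_cons, List.mem_cons, hr, or_true])
    rw [lambdaDC] at ih ⊢
    rw [OnlineAlgorithm.cost_ofStep_cons]
    simp only [hm, moveCost_self, zero_add]
    exact ih

/-! ### Erasing the memory -/

/-- Rank of a configuration `s` with respect to the target `x`: a server that is to the left of
its target counts the servers from it to the right end, and symmetrically. -/
noncomputable def displacementRank {k : ℕ} (s x : Fin k → ℝ) : ℝ :=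
  ∑ i, if s i < x i then (k : ℝ) - i.1 else if x i < s i then (i.1 : ℝ) + 1 else 0

theorem displacementRank_nonneg {k : ℕ} (s x : Fin k → ℝ) : 0 ≤ displacementRank s x := by
  refine Finset.sum_nonneg fun i _ => ?_
  have : (i.1 : ℝ) ≤ k := by exact_mod_cast i.2.le
  split_ifs
  · linarith
  · positivity
  · exact le_rfl

theorem lambdaDCMove_rank_or_gap_of_lt {k : ℕ} {lam : ℝ} (h0 : 0 ≤ lam) {s x : Fin k → ℝ}
    (hs : Monotone s) (hx : StrictMono x) {p : Fin k} (hp : s p < x p)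
    (hmax : ∀ a, p < a → x a ≤ s a) :
    displacementRank (lambdaDCMove lam s (x p) p) x + 1 ≤ displacementRank s x ∨
      ∃ a b, x a < x b ∧ x b - x a ≤ moveCost s (lambdaDCMove lam s (x p) p) := by
  have hle : ∀ a, s a ≤ x p → a ≤ p := fun a ha => by
    by_contra! h
    linarith [hmax a h, hx h]
  have hlt : ∀ a, x p < s a → p < a := fun a ha => by
    by_contra! h
    linarith [hs h]
  have hpk : (p.1 : ℝ) + 1 ≤ k := by exact_mod_cast p.2
  rcases lambdaDCMove_cases h0 hs (x p) p with ⟨⟨i, hi⟩, -⟩ | ⟨i, hi, hir, h⟩ | ⟨i, hi, hir, -⟩ |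
    ⟨i, j, u, v, hij, hir, hjr, hu, hv, -, -, hor, hq, h⟩
  · linarith [hs (hle i hi.le)]
  · obtain rfl := le_antisymm (hle i hir.le) (hi p)
    left
    have hsum := sum_sub_sum_eq_of_eq_off (i := i)
      (f := fun a => if Function.update s i (x i) a < x a then (k : ℝ) - a.1 else
        if x a < Function.update s i (x i) a then (a.1 : ℝ) + 1 else 0)
      (g := fun a => if s a < x a then (k : ℝ) - a.1 else
        if x a < s a then (a.1 : ℝ) + 1 else 0)
      fun a ha => by simp only [Function.update_of_ne ha]
    simp only [Function.update_self, lt_irrefl, if_false, if_pos hp] at hsum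
    rw [h, displacementRank, displacementRank]
    linarith
  · exact absurd (hlt i hir) (not_lt.2 (hi p))
  · obtain rfl : i = p := by
      have h1 := hle i hir.le
      have h2 := hlt j hjr
      rw [Fin.le_def] at h1
      rw [Fin.lt_def] at h2
      exact Fin.ext (by omega)
    have hlij : i < j := hlt j hjr
    set t := lambdaDCMove lam s (x i) i
    have ti : t i = s i + u := by rw [h, Function.update_of_ne hlij.ne, Function.update_self]
    have tj : t j = s j - v := by rw [h, Function.update_self]
    rcases hor with ho | ho
    · left
      have hsum := sum_sub_sum_eq_of_eq_off_pair hlij.ne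
        (f := fun a => if t a < x a then (k : ℝ) - a.1 else if x a < t a then (a.1 : ℝ) + 1 else 0)
        (g := fun a => if s a < x a then (k : ℝ) - a.1 else if x a < s a then (a.1 : ℝ) + 1 else 0)
        fun a hi hj => by simp only [h, Function.update_of_ne hi, Function.update_of_ne hj]
      simp only [ti, tj, ho, lt_irrefl, if_false, if_pos hp] at hsum
      have hj1 : (j.1 : ℝ) = i.1 + 1 := by exact_mod_cast hij.symm
      have hj2 : (j.1 : ℝ) + 1 ≤ k := by exact_mod_cast j.2
      rw [if_neg (not_lt.2 (hmax j hlij)), hj1] at hsum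
      simp only [displacementRank]
      split_ifs at hsum <;> linarith
    · right
      refine ⟨i, j, hx hlij, ?_⟩
      have := abs_le_moveCost s t j
      rw [tj, ho] at this
      linarith [le_abs_self (s j - x i), hmax j hlij]

theorem lambdaDCMove_rank_or_gap_of_gt {k : ℕ} {lam : ℝ} (h0 : 0 ≤ lam) {s x : Fin k → ℝ}
    (hs : Monotone s) (hx : StrictMono x) {p : Fin k} (hp : x p < s p)
    (hmin : ∀ a, a < p → s a ≤ x a) :
    displacementRank (lambdaDCMove lam s (x p) p) x + 1 ≤ displacementRank s x ∨
      ∃ a b, x a < x b ∧ x b - x a ≤ moveCost s (lambdaDCMove lam s (x p) p) := by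
  have hle : ∀ a, x p ≤ s a → p ≤ a := fun a ha => by
    by_contra! h
    linarith [hmin a h, hx h]
  have hlt : ∀ a, s a < x p → a < p := fun a ha => by
    by_contra! h
    linarith [hs h]
  rcases lambdaDCMove_cases h0 hs (x p) p with ⟨⟨i, hi⟩, -⟩ | ⟨i, hi, hir, -⟩ | ⟨i, hi, hir, h⟩ |
    ⟨i, j, u, v, hij, hir, hjr, hu, hv, -, -, hor, hq, h⟩
  · linarith [hs (hle i hi.ge)]
  · exact absurd (hlt i hir) (not_lt.2 (hi p))
  · obtain rfl := le_antisymm (hi p) (hle i hir.le)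
    left
    have hsum := sum_sub_sum_eq_of_eq_off (i := i)
      (f := fun a => if Function.update s i (x i) a < x a then (k : ℝ) - a.1 else
        if x a < Function.update s i (x i) a then (a.1 : ℝ) + 1 else 0)
      (g := fun a => if s a < x a then (k : ℝ) - a.1 else
        if x a < s a then (a.1 : ℝ) + 1 else 0)
      fun a ha => by simp only [Function.update_of_ne ha]
    simp only [Function.update_self, lt_irrefl, if_false, if_pos hp, if_neg hp.not_gt] at hsum
    rw [h, displacementRank, displacementRank]
    linarith [Nat.cast_nonneg (α := ℝ) i.1]
  · obtain rfl : j = p := by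
      have h1 := hle j hjr.le
      have h2 := hlt i hir
      rw [Fin.le_def] at h1
      rw [Fin.lt_def] at h2
      exact Fin.ext (by omega)
    have hlij : i < j := hlt i hir
    set t := lambdaDCMove lam s (x j) j
    have ti : t i = s i + u := by rw [h, Function.update_of_ne hlij.ne, Function.update_self]
    have tj : t j = s j - v := by rw [h, Function.update_self]
    rcases hor with ho | ho
    · right
      refine ⟨i, j, hx hlij, ?_⟩
      have := abs_le_moveCost s t i
      rw [ti, ho] at this
      linarith [neg_abs_le (s i - x j), hmin i hlij]
    · left
      have hsum := sum_sub_sum_eq_of_eq_off_pair hlij.ne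
        (f := fun a => if t a < x a then (k : ℝ) - a.1 else if x a < t a then (a.1 : ℝ) + 1 else 0)
        (g := fun a => if s a < x a then (k : ℝ) - a.1 else if x a < s a then (a.1 : ℝ) + 1 else 0)
        fun a hi hj => by simp only [h, Function.update_of_ne hi, Function.update_of_ne hj]
      simp only [ti, tj, ho, lt_irrefl, if_false, if_pos hp, if_neg hp.not_gt,
        if_neg (not_lt.2 (hmin i hlij))] at hsum
      have hj1 : (j.1 : ℝ) = i.1 + 1 := by exact_mod_cast hij.symm
      have hj2 : (j.1 : ℝ) + 1 ≤ k := by exact_mod_cast j.2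
      rw [hj1] at hsum
      simp only [displacementRank]
      split_ifs at hsum <;> linarith

theorem exists_lambdaDCMove_rank_or_gap {k : ℕ} {lam : ℝ} (h0 : 0 ≤ lam) {s x : Fin k → ℝ}
    (hs : Monotone s) (hx : StrictMono x) (hne : s ≠ x) : ∃ p,
      displacementRank (lambdaDCMove lam s (x p) p) x + 1 ≤ displacementRank s x ∨
      ∃ a b, x a < x b ∧ x b - x a ≤ moveCost s (lambdaDCMove lam s (x p) p) := by
  by_cases hL : (Finset.univ.filter fun i => s i < x i).Nonempty
  · refine ⟨_, lambdaDCMove_rank_or_gap_of_lt h0 hs hx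
      (Finset.mem_filter.1 (Finset.max'_mem _ hL)).2 fun a ha => ?_⟩
    by_contra! h
    exact ha.not_ge (Finset.le_max' _ a (by simpa using h))
  · have hge : ∀ i, x i ≤ s i := fun i => by
      by_contra! h
      exact hL ⟨i, by simpa using h⟩
    obtain ⟨i, hi⟩ := Function.ne_iff.1 hne
    have hR : (Finset.univ.filter fun i => x i < s i).Nonempty :=
      ⟨i, by simpa using lt_of_le_of_ne' (hge i) hi⟩
    refine ⟨_, lambdaDCMove_rank_or_gap_of_gt h0 hs hx
      (Finset.mem_filter.1 (Finset.min'_mem _ hR)).2 fun a ha => ?_⟩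
    by_contra! h
    exact ha.not_ge (Finset.min'_le _ a (by simpa using h))

theorem exists_pos_le_gap {k : ℕ} (x : Fin k → ℝ) :
    ∃ g > 0, ∀ a b, x a < x b → g ≤ x b - x a := by
  classical
  cases isEmpty_or_nonempty (Fin k)
  · exact ⟨1, one_pos, fun a => isEmptyElim a⟩
  obtain ⟨q, hq⟩ := Finite.exists_min fun q : Fin k × Fin k =>
    if x q.1 < x q.2 then x q.2 - x q.1 else 1
  refine ⟨_, ?_, fun a b hab => (hq (a, b)).trans_eq (if_pos hab)⟩
  split_ifs with h
  · exact sub_pos.2 h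
  · exact one_pos

theorem exists_requests_config_eq {k : ℕ} (lam : Set.Icc (0 : ℝ) 1) {x : Fin k → ℝ}
    (hx : StrictMono x) (C : Config k) : ∃ σ : List (ℝ × Fin k),
      (∀ q ∈ σ, q.1 ∈ Set.range x) ∧ ((lambdaDC k lam).config C σ).1 = x := by
  obtain ⟨g, hg, hgap⟩ := exists_pos_le_gap x
  obtain ⟨N, hN⟩ := exists_nat_gt (consPotential k lam C.1 x / g)
  obtain ⟨n, hn⟩ := exists_nat_gt (displacementRank C.1 x)
  rw [div_lt_iff₀ hg] at hN
  induction N generalizing C n with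
  | zero =>
    rcases Nat.eq_zero_or_pos k with rfl | hk
    · exact ⟨[], by simp, Subsingleton.elim _ _⟩
    · have := consPotential_nonneg hk lam.2.1 C.2 x
      simp only [Nat.cast_zero, zero_mul] at hN
      linarith
  | succ N ihN =>
    induction n generalizing C with
    | zero => exact absurd hn (not_lt.2 (by simpa using displacementRank_nonneg C.1 x))
    | succ n ihn =>
      by_cases hne : C.1 = x
      · exact ⟨[], by simp, hne⟩
      obtain ⟨p, hp⟩ := exists_lambdaDCMove_rank_or_gap lam.2.1 C.2 hx hne
      have hΦ := lambdaDCMove_consPotential_le lam.2.1 lam.2.2 C.2 hx.monotone p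
      have hM := moveCost_nonneg C.1 (lambdaDCMove lam C.1 (x p) p)
      set C' : Config k :=
        ⟨lambdaDCMove lam C.1 (x p) p, (lambdaDCMove_spec lam.2.1 C.2 (x p) p).1⟩ with hC'
      suffices h : ∃ σ : List (ℝ × Fin k),
          (∀ q ∈ σ, q.1 ∈ Set.range x) ∧ ((lambdaDC k lam).config C' σ).1 = x by
        obtain ⟨σ, h1, h2⟩ := h
        exact ⟨(x p, p) :: σ, by simpa using h1, h2⟩
      rcases hp with hp | ⟨a, b, hab, hp⟩
      · refine ihn C' (by simp only [hC']; linarith) ?_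
        simp only [hC']
        push_cast at hn
        linarith
      · obtain ⟨m, hm⟩ := exists_nat_gt (displacementRank C'.1 x)
        refine ihN C' ?_ m hm
        have := hgap a b hab
        simp only [hC']
        push_cast at hN
        linarith

theorem lambdaDC_isMemoryConstrained (k : ℕ) (lam : Set.Icc (0 : ℝ) 1) :
    (lambdaDC k lam).IsMemoryConstrained := by
  refine ⟨⟨fun C r p => ⟨lambdaDCMove lam C.1 r p, (lambdaDCMove_spec lam.2.1 C.2 r p).1⟩,
    fun C₀ σ r p => ?_⟩, fun P hP C₀ => ?_⟩
  · simp [lambdaDC, OnlineAlgorithm.ofStep, List.foldl_append]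
  · obtain ⟨σ, h1, h2⟩ := exists_requests_config_eq lam (P.orderEmbOfFin hP).strictMono C₀
    refine ⟨σ, fun q hq => ?_, fun q hq => ?_⟩
    · obtain ⟨i, hi⟩ := h1 q hq
      exact hi ▸ P.orderEmbOfFin_mem hP i
    · rw [h2]
      obtain ⟨i, rfl⟩ : q ∈ Set.range (P.orderEmbOfFin hP) := by simpa using hq
      exact ⟨i, rfl, fun j hj => (P.orderEmbOfFin hP).injective hj⟩

/-! ### Main result -/

theorem ofReal_le_mul_ofReal_add {x a y : ℝ} {c c' : ℝ≥0} (ha : 0 ≤ a) (hy : 0 ≤ y)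
    (h : x ≤ a * y + c) (hc : c ≤ c') :
    ENNReal.ofReal x ≤ ENNReal.ofReal a * ENNReal.ofReal y + c' := by
  rw [← ENNReal.ofReal_mul ha, ← ENNReal.ofReal_coe_nnreal (p := c'),
    ← ENNReal.ofReal_add (mul_nonneg ha hy) c'.coe_nonneg]
  exact ENNReal.ofReal_le_ofReal (h.trans (by gcongr))

theorem theorem1 (k : ℕ) (hk : 1 ≤ k) (lam : Set.Icc (0 : ℝ) 1) :
    (lambdaDC k lam).IsMemoryConstrained ∧
    (lambdaDC k lam).IsCompetitive (fun C₀ σ =>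
      min (ENNReal.ofReal
            (alpha k lam * (1 + predictionError C₀ σ / opt C₀ (σ.map Prod.fst))))
          (beta k lam)) ∧
    (lambdaDC k lam).IsConsistent (ENNReal.ofReal (alpha k lam)) ∧
    (0 < (lam : ℝ) → (lambdaDC k lam).IsRobust (beta k lam)) := by
  have hα := one_le_alpha hk lam.2.1
  have hcons : ∀ C₀ : Config k, ∃ c : ℝ≥0, ∀ σ, (lambdaDC k lam).cost C₀ σ ≤
      alpha k lam * (ftp k).cost C₀ σ + c := fun C₀ =>
    ⟨⟨_, consPotential_nonneg hk lam.2.1 C₀.2 C₀.1⟩, fun σ => lambdaDC_cost_le_ftp hk lam σ C₀ C₀⟩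
  have hrob : ∀ C₀ : Config k, ∃ c : ℝ≥0, 0 < (lam : ℝ) → ∀ σ, (lambdaDC k lam).cost C₀ σ ≤
      (∑ i ∈ Finset.range k, (lam.1 ^ i)⁻¹) * opt C₀ (σ.map Prod.fst) + c := fun C₀ =>
    ⟨⟨_, potential_nonneg (robWeight_nonneg lam.2.1) (robCoeff_mono lam.2.1)
      (robCoeff_rev lam.1) C₀.2 C₀.1⟩, fun h0 σ => lambdaDC_cost_le_opt hk lam h0 C₀ σ⟩
  have hβ : 0 ≤ ∑ i ∈ Finset.range k, (lam.1 ^ i)⁻¹ :=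
    Finset.sum_nonneg fun i _ => inv_nonneg.2 (pow_nonneg lam.2.1 i)
  refine ⟨lambdaDC_isMemoryConstrained k lam, fun C₀ => ?_, fun C₀ => ?_, fun h0 C₀ => ?_⟩
  · obtain ⟨c₁, h₁⟩ := hcons C₀
    obtain ⟨c₂, h₂⟩ := hrob C₀
    refine ⟨c₁ + c₂, fun σ => ?_⟩
    rcases (opt_nonneg C₀ (σ.map Prod.fst)).eq_or_lt with ho | ho
    · rw [lambdaDC_cost_eq_zero lam C₀ fun r hr => exists_eq_of_opt_eq_zero hk ho.symm hr]
      simp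
    have hftp : 0 ≤ (ftp k).cost C₀ σ := scheduleCost_nonneg _ _
    rcases min_choice (ENNReal.ofReal
      (alpha k lam * (1 + predictionError C₀ σ / opt C₀ (σ.map Prod.fst))))
      (beta k lam) with hm | hm <;> simp only [hm]
    · have he : 1 + predictionError C₀ σ / opt C₀ (σ.map Prod.fst) =
          (ftp k).cost C₀ σ / opt C₀ (σ.map Prod.fst) := by
        rw [predictionError]; field_simp; ring
      refine ofReal_le_mul_ofReal_add (c := c₁) ?_ ho.le ?_ (by simp)
      · rw [he]; positivity
      · rw [he, mul_assoc, div_mul_cancel₀ _ ho.ne']; exact h₁ σ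
    · by_cases hl : (lam : ℝ) = 0
      · rw [beta, if_pos hl, ENNReal.top_mul (by simpa using ho)]
        simp
      · rw [beta, if_neg hl]
        exact ofReal_le_mul_ofReal_add (c := c₂) hβ ho.le
          (h₂ (lam.2.1.lt_of_ne' hl) σ) (by simp)
  · obtain ⟨c₁, h₁⟩ := hcons C₀
    refine ⟨c₁, fun σ he => ofReal_le_mul_ofReal_add (by linarith) (opt_nonneg _ _) ?_ le_rfl⟩
    rw [← sub_eq_zero.1 he]
    exact h₁ σ
  · obtain ⟨c₂, h₂⟩ := hrob C₀
    refine ⟨c₂, fun σ => ?_⟩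
    simp only [beta, if_neg h0.ne']
    exact ofReal_le_mul_ofReal_add hβ (opt_nonneg _ _) (h₂ h0 σ) le_rfl
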